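/- **Setting.** Let $N,S\ge 1$. For $i\in\{1,\dots,N\}$ let $c_i\in\mathbb R^{n_i}$, $A_i\in\mathbb R^{S\times n_i}$ with rows $A_i^s$, and let $X_i=\{x\in\mathbb Z^{Z_i}\times\mathbb R^{R_i}: D_i x\preceq d_i\}$ ($Z_i+R_i=n_i$) be nonempty and compact; let $b\in\mathbb R^S$. Here $\preceq$ is the componentwise order and $\mathbf 1$ the all-ones vector. The original MILP is $$\min \sum_{i=1}^N c_i^\top x_i\quad\text{subject to}\quad \sum_{i=1}^N A_i x_i\preceq b,\quad x_i\in X_i\ (i=1,\dots,N).$$ **Restriction.** Put $L_i^s=\min_{x\in X_i}A_i^s x$, $L_i=(L_i^1,\dots,L_i^S)$, and let $(x_i^L,\tilde\ell_i)$ be an optimal solution of $\min\{\ell : A_i x-L_i\preceq \ell\mathbf 1,\ x\in X_i,\ \ell\in\mathbb R\}$. Define $$\sigma^{\mathrm{ASY}}=(S+1)\max_{1\le i\le N}\ \max_{1\le s\le S}\bigl(A_i^s x_i^L-L_i^s\bigr),\qquad \sigma=\sigma^{\mathrm{ASY}}\mathbf 1 .$$ Assume that the restricted linear program $$\min \sum_{i=1}^N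 c_i^\top z_i\quad\text{subject to}\quad \sum_{i=1}^N A_i z_i\preceq b-\sigma,\quad z_i\in\operatorname{conv}(X_i)$$ is feasible and that its optimal solution is unique. **Algorithm.** Let $\mathcal G$ be a connected undirected graph on $\{1,\dots,N\}$ with neighbour sets $\mathcal N_i$, let $M>0$, and let $\alpha^t\ge 0$ satisfy $\sum_t\alpha^t=\infty$ and $\sum_t(\alpha^t)^2<\infty$. Start from any $y_i^0\in\mathbb R^S$ with $\sum_i y_i^0=b-\sigma$. At each step $t\ge 0$ let $\mu_i^t$ be any optimal solution of the Lagrangian dual (with respect to the constraint $A_i z\preceq y_i^t+v\mathbf 1$) of $$\min_{z,v}\ c_i^\top z+Mv\quad\text{subject to}\quad A_i z\preceq y_i^t+v\mathbf 1,\quad z\in\operatorname{conv}(X_i),\ v\ge 0,$$ and set $y_i^{t+1}=y_i^t+\alpha^t\sum_{j\in\mathcal N_i}(\mu_i^t-\mu_j^t)$. **Theorem (Feasibility).** For all sufficiently large $M$ (with a threshold depending only on the data $N,S,c_i,A_i,X_i,b$ of the MILP and the points $x_i^L$, not on the graph, the step sizes, the initial allocations or the choice of dual solutions), the allocation sequences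 generated by the algorithm converge, $y_i^t\to y_i^\infty$ for every $i$, and the following holds. For every $i$ let $(\rho_i^\infty,\xi_i^\infty,x_i^\infty)$ be any lex-optimal solution of $$\operatorname*{lex\text{-}min}_{\rho,\xi,x}\ (\rho,\xi)\quad\text{subject to}\quad c_i^\top x\le\xi,\quad A_i x\preceq y_i^\infty+\rho\mathbf 1,\quad x\in X_i,\ \rho\ge 0 .$$ Then $(x_1^\infty,\dots,x_N^\infty)$ is feasible for the original MILP, i.e. $x_i^\infty\in X_i$ for all $i$ and $\sum_{i=1}^N A_i x_i^\infty\preceq b$. -/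

import Mathlib

open Matrix

/-- The data of a constraint-coupled mixed-integer linear program with `N` agents and `S`
coupling constraints:
minimise `∑ i, c i ⬝ᵥ x i` subject to `∑ i, A i *ᵥ x i ≤ b` and `x i ∈ X i`, where `X i` is the set
of points of `ℤ ^ nZ i × ℝ ^ nR i` with `D i *ᵥ x ≤ d i`. -/
structure CoupledMILP (N S : ℕ) where
  /-- number of integer variables of each agent -/
  nZ : Fin N → ℕ
  /-- number of real variables of each agent -/
  nR : Fin N → ℕ
  /-- number of local inequalities of each agent -/
  m : Fin N → ℕ
  D : (i : Fin N) → Matrix (Fin (m i)) (Fin (nZ i) ⊕ Fin (nR i)) ℝ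
  d : (i : Fin N) → Fin (m i) → ℝ
  c : (i : Fin N) → Fin (nZ i) ⊕ Fin (nR i) → ℝ
  A : (i : Fin N) → Matrix (Fin S) (Fin (nZ i) ⊕ Fin (nR i)) ℝ
  b : Fin S → ℝ

namespace CoupledMILP

variable {N S : ℕ} (P : CoupledMILP N S)

/-- The real space in which the variable of agent `i` lives: integer coordinates first. -/
abbrev Var (i : Fin N) : Type := Fin (P.nZ i) ⊕ Fin (P.nR i) → ℝ

/-- The local mixed-integer polyhedral constraint set of agent `i`. -/
def X (i : Fin N) : Set (P.Var i) :=
  {x | (∀ k : Fin (P.nZ i), ∃ a : ℤ, x (Sum.inl k) = (a : ℝ)) ∧ P.D i *ᵥ x ≤ P.d i}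

/-- Feasibility for the original mixed-integer program. -/
def IsFeasible (x : (i : Fin N) → P.Var i) : Prop :=
  (∀ i, x i ∈ P.X i) ∧ ∑ i, P.A i *ᵥ x i ≤ P.b

/-- Feasible set of the linear program obtained by replacing each `X i` by its convex hull and
`b` by `b - σ`. -/
def lpFeasible (σ : Fin S → ℝ) : Set ((i : Fin N) → P.Var i) :=
  {z | (∀ i, z i ∈ convexHull ℝ (P.X i)) ∧ ∑ i, P.A i *ᵥ z i ≤ P.b - σ}

/-- Optimal solutions of that linear program. -/
def IsLPOptimal (σ : Fin S → ℝ) (z : (i : Fin N) → P.Var i) : Prop :=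
  z ∈ P.lpFeasible σ ∧
    ∀ z' ∈ P.lpFeasible σ, ∑ i, P.c i ⬝ᵥ z i ≤ ∑ i, P.c i ⬝ᵥ z' i

/-- The restricted linear program is feasible and has exactly one optimal solution. -/
def LPUniquelySolvable (σ : Fin S → ℝ) : Prop :=
  (P.lpFeasible σ).Nonempty ∧ ∃! z, P.IsLPOptimal σ z

/-- The lower bound vector: component `s` is the minimum over `X i` of row `s` of `A i`
applied to `x`. -/
noncomputable def lowerBound (i : Fin N) (s : Fin S) : ℝ :=
  sInf ((fun x : P.Var i => (P.A i *ᵥ x) s) '' P.X i)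

/-- Feasible pairs `(x, ℓ)` of the problem: minimise `ℓ` subject to `A i *ᵥ x - L i ≤ ℓ 1`,
`x ∈ X i`, `ℓ ∈ ℝ`. -/
def lowestFeasible (i : Fin N) : Set (P.Var i × ℝ) :=
  {w | w.1 ∈ P.X i ∧ ∀ s, (P.A i *ᵥ w.1) s - P.lowerBound i s ≤ w.2}

/-- Optimal solutions `(x, ℓ)` of that problem. -/
def IsLowest (i : Fin N) (x : P.Var i) (ℓ : ℝ) : Prop :=
  (x, ℓ) ∈ P.lowestFeasible i ∧ ∀ w ∈ P.lowestFeasible i, ℓ ≤ w.2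

/-- The size of the restriction,
`(S + 1) * max_i max_s ((A i *ᵥ xL i) s - L i s)`. -/
noncomputable def sigmaASY (xL : (i : Fin N) → P.Var i) : ℝ :=
  ((S : ℝ) + 1) * ⨆ i, ⨆ s, ((P.A i *ᵥ xL i) s - P.lowerBound i s)

/-- Lagrangian, with the coupling constraint `A i *ᵥ z ≤ y + v 1` dualised, of the relaxed local
linear program: minimise `c i ⬝ᵥ z + M * v` subject to `A i *ᵥ z ≤ y + v 1`,
`z ∈ conv (X i)`, `v ≥ 0`. -/
noncomputable def lagrangian (i : Fin N) (M : ℝ) (y μ : Fin S → ℝ) (z : P.Var i) (v : ℝ) : ℝ :=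
  P.c i ⬝ᵥ z + M * v + μ ⬝ᵥ (P.A i *ᵥ z - (y + fun _ => v))

/-- The dual function of the relaxed local linear program (it may take the value `-∞`). -/
noncomputable def dualFunction (i : Fin N) (M : ℝ) (y μ : Fin S → ℝ) : EReal :=
  ⨅ z ∈ convexHull ℝ (P.X i), ⨅ v ∈ Set.Ici (0 : ℝ), (P.lagrangian i M y μ z v : EReal)

/-- Dual optimal solutions of the relaxed local linear program. -/
def IsDualOptimal (i : Fin N) (M : ℝ) (y μ : Fin S → ℝ) : Prop :=
  0 ≤ μ ∧ ∀ μ' : Fin S → ℝ, 0 ≤ μ' → P.dualFunction i M y μ' ≤ P.dualFunction i M y μ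

/-- `y` (allocations) and `μ` (dual solutions) are sequences generated by the distributed
algorithm over the graph `G` with penalty `M`, step sizes `α` and restriction `σ`. -/
structure IsRun (G : SimpleGraph (Fin N)) [DecidableRel G.Adj] (M : ℝ) (α : ℕ → ℝ)
    (σ : Fin S → ℝ) (y μ : ℕ → Fin N → Fin S → ℝ) : Prop where
  init : ∑ i, y 0 i = P.b - σ
  dual : ∀ t i, P.IsDualOptimal i M (y t i) (μ t i)
  step : ∀ t i, y (t + 1) i = y t i + α t • ∑ j ∈ G.neighborFinset i, (μ t i - μ t j)

/-- Feasible triples `(ρ, ξ, x)` of the local lexicographic mixed-integer program with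
allocation `y`. -/
def lexFeasible (i : Fin N) (y : Fin S → ℝ) : Set (ℝ × ℝ × P.Var i) :=
  {w | P.c i ⬝ᵥ w.2.2 ≤ w.2.1 ∧ P.A i *ᵥ w.2.2 ≤ (y + fun _ => w.1) ∧ w.2.2 ∈ P.X i ∧ 0 ≤ w.1}

/-- Lex-optimal solutions: `(ρ, ξ)` is minimal in the lexicographic order. -/
def IsLexOptimal (i : Fin N) (y : Fin S → ℝ) (ρ ξ : ℝ) (x : P.Var i) : Prop :=
  (ρ, ξ, x) ∈ P.lexFeasible i y ∧
    ∀ w ∈ P.lexFeasible i y, toLex (ρ, ξ) ≤ toLex (w.1, w.2.1)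

end CoupledMILP

/-- Diminishing step sizes: nonnegative, with `∑ α = ∞` and `∑ α ^ 2 < ∞`. -/
structure IsDiminishingStep (α : ℕ → ℝ) : Prop where
  nonneg : ∀ t, 0 ≤ α t
  sum_eq_top : Filter.Tendsto (fun T => ∑ t ∈ Finset.range T, α t) Filter.atTop Filter.atTop
  summable_sq : Summable fun t => α t ^ 2

/-! Let `f i y` be the value of the relaxed local program at allocation `y`. By duality `-μ i` is a
subgradient of `f i` and `∑ s, μ i s ≤ M`, so the algorithm is a subgradient method, preconditioned
by the graph Laplacian, for minimising `∑ i, f i (y i)` over allocations of fixed sum. In the norm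
of an inverse Laplacian the squared distance to any minimiser decreases up to summable errors, which
gives convergence to a minimiser (`tendsto_distributed_subgradient`).

If `M` exceeds the total price `∑ s, ν s` of an optimal multiplier of the restricted program
(`exists_coupling_multiplier`), violations never pay: at the limit all `v i` vanish, so the local
solutions solve the restricted program and equal its unique solution `z`, with `A i z i ≤ yInf i`.

Uniqueness also makes `z` nearly integral: `S + 2` components outside `X i` would give a linear
dependence in `ℝ × ℝ^S`, hence another optimum (`card_notMem_X_le`). Where `z i ∈ X i` the
lexicographic program needs `ρ i = 0`; elsewhere `xL i` shows that `ρ i` is at most the largest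
excess `Δ` over the lower bounds. The total violation is at most `(S + 1) * Δ`, exactly the amount
withheld from `b`. -/

open Matrix Filter Topology

/-! ### Farkas' lemma and linear programming duality over polytopes -/

/-- **Farkas' lemma** for finitely many linear functionals on a real vector space. -/
theorem farkas {E κ : Type*} [AddCommGroup E] [Module ℝ E] (s : Finset κ) :
    ∀ (a : κ → E →ₗ[ℝ] ℝ) (b : E →ₗ[ℝ] ℝ),
      (∀ x, (∀ k ∈ s, a k x ≤ 0) → b x ≤ 0) →
        ∃ u : κ → ℝ, (∀ k, 0 ≤ u k) ∧ ∀ x, b x = ∑ k ∈ s, u k * a k x := by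
  classical
  induction s using Finset.induction_on with
  | empty =>
    intro a b h
    refine ⟨0, fun _ => le_rfl, fun x => ?_⟩
    have h1 := h x (by simp)
    have h2 := h (-x) (by simp)
    rw [map_neg] at h2
    simp only [Finset.sum_empty]
    linarith
  | insert m s hm ih =>
    intro a b h
    by_cases hs : ∀ x, (∀ k ∈ s, a k x ≤ 0) → b x ≤ 0
    · obtain ⟨u, hu, hb⟩ := ih a b hs
      refine ⟨fun k => if k = m then 0 else u k, fun k => ?_, fun x => ?_⟩
      · dsimp only
        split_ifs
        exacts [le_rfl, hu k]
      · beta_reduce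
        rw [Finset.sum_insert hm, hb x, if_pos rfl, zero_mul, zero_add]
        refine Finset.sum_congr rfl fun k hk => ?_
        rw [if_neg (ne_of_mem_of_not_mem hk hm)]
    · push Not at hs
      obtain ⟨x₁, hx₁, hbx₁⟩ := hs
      have ham : 0 < a m x₁ := by
        by_contra! hle
        refine hbx₁.not_ge (h x₁ fun k hk => ?_)
        rcases Finset.mem_insert.1 hk with rfl | hk
        exacts [hle, hx₁ k hk]
      obtain ⟨x₀, hx₀, hbx₀, hmx₀⟩ :
          ∃ x₀, (∀ k ∈ s, a k x₀ ≤ 0) ∧ 0 < b x₀ ∧ a m x₀ = 1 := by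
        refine ⟨(a m x₁)⁻¹ • x₁, fun k hk => ?_, ?_, ?_⟩
        · rw [map_smul, smul_eq_mul]
          exact mul_nonpos_of_nonneg_of_nonpos (inv_nonneg.2 ham.le) (hx₁ k hk)
        · rw [map_smul, smul_eq_mul]
          positivity
        · rw [map_smul, smul_eq_mul, inv_mul_cancel₀ ham.ne']
      -- The functionals are composed with the projection `x ↦ x - a m x • x₀` onto the kernel of `a
      -- m`; evaluation at `x₀` then dictates the weight of `m`.
      obtain ⟨u, hu, hb⟩ := ih (fun k => a k - (a k x₀) • a m) (b - (b x₀) • a m) fun x hx => by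
        have key := h (x - a m x • x₀) fun k hk => by
          rcases Finset.mem_insert.1 hk with rfl | hk
          · simp [hmx₀]
          · have := hx k hk
            simp only [LinearMap.sub_apply, LinearMap.smul_apply, smul_eq_mul, map_sub,
              map_smul] at this ⊢
            linarith
        simp only [LinearMap.sub_apply, LinearMap.smul_apply, smul_eq_mul, map_sub,
          map_smul] at key ⊢
        linarith
      refine ⟨fun k => if k = m then b x₀ - ∑ k ∈ s, u k * a k x₀ else u k, fun k => ?_,
        fun x => ?_⟩
      · dsimp only
        split_ifs
        · have : ∑ k ∈ s, u k * a k x₀ ≤ 0 := Finset.sum_nonpos fun k hk =>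
            mul_nonpos_of_nonneg_of_nonpos (hu k) (hx₀ k hk)
          linarith
        · exact hu k
      · beta_reduce
        rw [Finset.sum_insert hm, if_pos rfl]
        have h1 : ∑ k ∈ s, (if k = m then b x₀ - ∑ k ∈ s, u k * a k x₀ else u k) * a k x =
            ∑ k ∈ s, u k * a k x := Finset.sum_congr rfl fun k hk => by
          rw [if_neg (ne_of_mem_of_not_mem hk hm)]
        have h2 := hb x
        simp only [LinearMap.sub_apply, LinearMap.smul_apply, smul_eq_mul, mul_sub,
          Finset.sum_sub_distrib] at h2
        have h3 : ∑ k ∈ s, u k * (a k x₀ * a m x) = (∑ k ∈ s, u k * a k x₀) * a m x := by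
          rw [Finset.sum_mul]
          exact Finset.sum_congr rfl fun k _ => by ring
        rw [h1]
        linarith

/-- Theorem of the alternative: if every nonnegative combination with nonpositive constraint
values has nonnegative cost, then some multiplier certifies this generator by generator. -/
theorem exists_multiplier_of_combinations {J ι : Type*} [Fintype J] [Fintype ι]
    (g : J → ℝ) (h : J → ι → ℝ)
    (H : ∀ t : J → ℝ, 0 ≤ t → ∑ j, t j • h j ≤ 0 → 0 ≤ ∑ j, t j * g j) :
    ∃ μ : ι → ℝ, 0 ≤ μ ∧ ∀ j, 0 ≤ g j + μ ⬝ᵥ h j := by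
  classical
  obtain ⟨u, hu, hb⟩ := farkas (Finset.univ : Finset (J ⊕ ι))
    (Sum.elim (fun j => -LinearMap.proj j)
      (fun s => ∑ j, (h j s) • (LinearMap.proj j : (J → ℝ) →ₗ[ℝ] ℝ)))
    (-∑ j, (g j) • (LinearMap.proj j : (J → ℝ) →ₗ[ℝ] ℝ)) fun t ht => by
      have h1 : 0 ≤ t := fun j => by simpa using ht (Sum.inl j) (Finset.mem_univ _)
      have h2 : ∑ j, t j • h j ≤ 0 := fun s => by
        simpa [mul_comm] using ht (Sum.inr s) (Finset.mem_univ _)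
      simpa [mul_comm] using H t h1 h2
  refine ⟨fun s => u (Sum.inr s), fun s => hu _, fun j => ?_⟩
  -- At a unit vector the identity says that `g j + μ ⬝ᵥ h j` is the weight of the sign constraint
  -- on `t j`.
  have h1 := hb (Pi.single j 1)
  simp only [LinearMap.neg_apply, LinearMap.sum_apply, LinearMap.smul_apply, LinearMap.proj_apply,
    smul_eq_mul, Fintype.sum_sum_type, Sum.elim_inl, Sum.elim_inr, Pi.single_apply, mul_ite,
    mul_one, mul_zero, mul_neg, Finset.sum_ite_eq', Finset.mem_univ,
    if_true, Finset.sum_neg_distrib] at h1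
  have h2 : (fun s => u (Sum.inr s)) ⬝ᵥ h j = ∑ s, u (Sum.inr s) * h j s := rfl
  rw [h2]
  have := hu (Sum.inl j)
  linarith

/-- Linear programming duality over the polytope `convexHull ℝ V`, with one extra nonnegative
variable of cost `a` and constraint column `w`. -/
theorem exists_multiplier_convexHull {E ι : Type*} [AddCommGroup E] [Module ℝ E] [Fintype ι]
    {V : Set E} (hV : V.Finite) (c : E →ₗ[ℝ] ℝ) (A : E →ₗ[ℝ] (ι → ℝ)) (y w : ι → ℝ) (p a : ℝ)
    (hray : ∀ v : ℝ, 0 ≤ v → v • w ≤ 0 → 0 ≤ v * a)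
    (H : ∀ z ∈ convexHull ℝ V, ∀ v : ℝ, 0 ≤ v → A z + v • w ≤ y → p ≤ c z + v * a) :
    ∃ μ : ι → ℝ, 0 ≤ μ ∧ 0 ≤ a + μ ⬝ᵥ w ∧
      ∀ z ∈ convexHull ℝ V, p ≤ c z + μ ⬝ᵥ (A z - y) := by
  classical
  have := hV.fintype
  obtain ⟨μ, hμ, hj⟩ := exists_multiplier_of_combinations (J := Option V)
    (fun o => o.elim a fun z => c z - p) (fun o => o.elim w fun z => A z - y) fun t ht hle => by
      simp only [Fintype.sum_option, Option.elim_none, Option.elim_some] at hle ⊢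
      -- Zero total weight on `V` leaves a pure ray, handled by `hray`; otherwise dividing by the
      -- total weight gives a point of the hull.
      rcases (Finset.sum_nonneg fun (z : V) _ => ht (some z)).eq_or_lt with h0 | hpos
      · have hz : ∀ z : V, t (some z) = 0 := fun z =>
          (Finset.sum_eq_zero_iff_of_nonneg fun (z : V) _ => ht (some z)).1 h0.symm z
            (Finset.mem_univ z)
        simp only [hz, zero_smul, Finset.sum_const_zero, add_zero, zero_mul] at hle ⊢
        exact hray _ (ht none) hle
      · set τ := ∑ z : V, t (some z) with hτ
        set z₀ : E := Finset.univ.centerMass (fun z : V => t (some z)) (fun z => (z : E)) with hz₀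
        have hmem : z₀ ∈ convexHull ℝ V :=
          Finset.centerMass_mem_convexHull _ (fun z _ => ht (some z)) hpos fun z _ => z.2
        have hτz : ∑ z : V, t (some z) • (z : E) = τ • z₀ := by
          rw [hz₀, Finset.centerMass, ← hτ, smul_smul, mul_inv_cancel₀ hpos.ne', one_smul]
        have hA : ∑ z : V, t (some z) • (A z - y) = τ • (A z₀ - y) := by
          simp only [smul_sub, Finset.sum_sub_distrib, ← Finset.sum_smul, ← map_smul, ← map_sum,
            hτz, ← hτ]
        have hc : ∑ z : V, t (some z) * (c z - p) = τ * (c z₀ - p) := by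
          simp only [← smul_eq_mul, smul_sub, Finset.sum_sub_distrib, ← Finset.sum_smul,
            ← map_smul, ← map_sum, hτz, ← hτ]
        rw [hA] at hle
        rw [hc]
        have key := H z₀ hmem (τ⁻¹ * t none) (mul_nonneg (inv_nonneg.2 hpos.le) (ht none))
          fun s => by
            have h1 := hle s
            simp only [Pi.add_apply, Pi.smul_apply, smul_eq_mul, Pi.sub_apply,
              Pi.zero_apply] at h1 ⊢
            have h2 : τ⁻¹ * (t none * w s + τ * (A z₀ s - y s)) ≤ 0 :=
              mul_nonpos_of_nonneg_of_nonpos (inv_nonneg.2 hpos.le) h1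
            have h3 : τ⁻¹ * (t none * w s + τ * (A z₀ s - y s)) =
                τ⁻¹ * t none * w s + (A z₀ s - y s) := by
              field_simp
            linarith
        have h4 : τ * p ≤ τ * (c z₀ + τ⁻¹ * t none * a) := mul_le_mul_of_nonneg_left key hpos.le
        have h5 : τ * (c z₀ + τ⁻¹ * t none * a) = τ * c z₀ + t none * a := by
          field_simp
        linarith
  refine ⟨μ, hμ, hj none, fun z hz => ?_⟩
  have hconv : Convex ℝ {z : E | p ≤ c z + μ ⬝ᵥ (A z - y)} := by
    have : {z : E | p ≤ c z + μ ⬝ᵥ (A z - y)} =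
        {z : E | p + μ ⬝ᵥ y ≤ (c + (dotProductBilin ℝ ℝ μ) ∘ₗ A) z} := by
      ext z
      simp only [Set.mem_ofPred_eq, dotProduct_sub, LinearMap.add_apply, LinearMap.comp_apply,
        dotProductBilin_apply_apply]
      constructor <;> intro h <;> linarith
    rw [this]
    exact convex_halfSpace_ge (LinearMap.isLinear _) _
  refine convexHull_min (fun v hv => ?_) hconv hz
  have := hj (some ⟨v, hv⟩)
  simp only [Option.elim_some] at this
  simp only [Set.mem_ofPred_eq]
  linarith

/-! ### Polyhedral structure of mixed-integer hulls -/

namespace CoupledMILP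

variable {N S : ℕ} (P : CoupledMILP N S)

/-- The points of `X i` with prescribed integer part. -/
def slice (i : Fin N) (a : Fin (P.nZ i) → ℤ) : Set (P.Var i) :=
  {x | (∀ k, x (Sum.inl k) = a k) ∧ P.D i *ᵥ x ≤ P.d i}

theorem slice_subset (i : Fin N) (a : Fin (P.nZ i) → ℤ) : P.slice i a ⊆ P.X i :=
  fun _ hx => ⟨fun k => ⟨a k, hx.1 k⟩, hx.2⟩

theorem isClosed_slice (i : Fin N) (a : Fin (P.nZ i) → ℤ) : IsClosed (P.slice i a) := by
  have hD : IsClosed {x : P.Var i | P.D i *ᵥ x ≤ P.d i} :=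
    isClosed_le (continuous_const.matrix_mulVec continuous_id) continuous_const
  have hint : IsClosed {x : P.Var i | ∀ k, x (Sum.inl k) = (a k : ℝ)} := by
    have : {x : P.Var i | ∀ k, x (Sum.inl k) = (a k : ℝ)} =
        ⋂ k, {x : P.Var i | x (Sum.inl k) = (a k : ℝ)} := by
      ext
      simp
    rw [this]
    exact isClosed_iInter fun k => isClosed_eq (continuous_apply _) continuous_const
  exact hint.inter hD

theorem convex_slice (i : Fin N) (a : Fin (P.nZ i) → ℤ) : Convex ℝ (P.slice i a) := by
  intro x hx y hy s t hs ht hst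
  refine ⟨fun k => ?_, ?_⟩
  · simp only [Pi.add_apply, Pi.smul_apply, hx.1 k, hy.1 k, smul_eq_mul]
    rw [← add_mul, hst, one_mul]
  · rw [mulVec_add, mulVec_smul, mulVec_smul]
    exact convex_Iic (P.d i) hx.2 hy.2 hs ht hst

/-- An extreme point of a slice is determined by its active inequalities. -/
theorem eq_of_mem_extremePoints_of_active {i : Fin N} {a : Fin (P.nZ i) → ℤ} {x y : P.Var i}
    (hx : x ∈ (P.slice i a).extremePoints ℝ) (hy : y ∈ P.slice i a)
    (hact : ∀ l, (P.D i *ᵥ x) l = P.d i l → (P.D i *ᵥ y) l = P.d i l) : x = y := by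
  -- Slightly overshooting `x` away from `y` stays feasible: active inequalities are constant along
  -- the line, the others are strict. Then `x` would lie strictly between two points of the slice.
  have hev : ∀ᶠ ε : ℝ in nhdsWithin 0 (Set.Ioi 0),
      ∀ l, (P.D i *ᵥ (x + ε • (x - y))) l ≤ P.d i l := by
    refine Filter.eventually_all.2 fun l => ?_
    simp only [mulVec_add, mulVec_smul, mulVec_sub, Pi.add_apply, Pi.smul_apply, Pi.sub_apply,
      smul_eq_mul]
    rcases (hx.1.2 l).eq_or_lt with h | h
    · refine Filter.Eventually.of_forall fun ε => ?_
      rw [h, hact l h]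
      simp
    · refine Filter.Eventually.filter_mono nhdsWithin_le_nhds ?_
      have hc : Filter.Tendsto (fun ε : ℝ => (P.D i *ᵥ x) l +
          ε * ((P.D i *ᵥ x) l - (P.D i *ᵥ y) l)) (nhds 0) (nhds ((P.D i *ᵥ x) l +
          0 * ((P.D i *ᵥ x) l - (P.D i *ᵥ y) l))) :=
        (Continuous.tendsto (by fun_prop) 0)
      rw [zero_mul, add_zero] at hc
      exact (hc.eventually_lt_const h).mono fun _ h => h.le
  obtain ⟨ε, hε, hεpos⟩ := (hev.and self_mem_nhdsWithin).exists
  have hεpos : 0 < ε := hεpos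
  have hmem : x + ε • (x - y) ∈ P.slice i a :=
    ⟨fun k => by simp [hx.1.1 k, hy.1 k], hε⟩
  refine (hx.2 hy hmem
    ⟨ε / (1 + ε), 1 / (1 + ε), by positivity, by positivity, by field_simp; ring, ?_⟩).symm
  ext k
  simp only [Pi.add_apply, Pi.smul_apply, Pi.sub_apply, smul_eq_mul]
  field_simp
  ring

theorem finite_extremePoints_slice (i : Fin N) (a : Fin (P.nZ i) → ℤ) :
    ((P.slice i a).extremePoints ℝ).Finite := by
  refine Set.Finite.of_finite_image (f := fun x : P.Var i => {l | (P.D i *ᵥ x) l = P.d i l})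
    (Set.toFinite _) fun x hx y hy hxy => P.eq_of_mem_extremePoints_of_active hx hy.1 fun l hl => ?_
  have : l ∈ {l | (P.D i *ᵥ x) l = P.d i l} := hl
  rw [show {l | (P.D i *ᵥ x) l = P.d i l} = {l | (P.D i *ᵥ y) l = P.d i l} from hxy] at this
  exact this

/-- The convex hull of a compact mixed-integer polyhedron is a polytope. -/
theorem exists_finite_convexHull_eq {i : Fin N} (hc : IsCompact (P.X i)) :
    ∃ V : Set (P.Var i), V.Finite ∧ convexHull ℝ (P.X i) = convexHull ℝ V := by
  classical
  obtain ⟨R, hR⟩ := hc.isBounded.exists_norm_le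
  -- Boundedness leaves finitely many integer parts, and Krein–Milman makes each slice the hull of
  -- its finitely many extreme points.
  set B : Set (Fin (P.nZ i) → ℤ) := {a | ∀ k, a k ∈ Set.Icc (-⌈R⌉) ⌈R⌉}
  have hB : B.Finite := Set.Finite.pi' fun _ => Set.finite_Icc _ _
  have hfin : (⋃ a ∈ B, (P.slice i a).extremePoints ℝ).Finite :=
    hB.biUnion fun a _ => P.finite_extremePoints_slice i a
  refine ⟨_, hfin, subset_antisymm (convexHull_min (fun x hx => ?_) (convex_convexHull ℝ _))
    (convexHull_mono (Set.iUnion₂_subset fun a _ =>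
      extremePoints_subset.trans (P.slice_subset i a)))⟩
  choose a ha using hx.1
  have haB : a ∈ B := fun k => by
    have h1 : |(a k : ℝ)| ≤ R := by
      rw [← ha]
      exact (norm_le_pi_norm x _).trans (hR x hx)
    have h2 := abs_le.1 (h1.trans (Int.le_ceil R))
    exact ⟨by exact_mod_cast h2.1, by exact_mod_cast h2.2⟩
  have hKM := closure_convexHull_extremePoints
    (hc.of_isClosed_subset (P.isClosed_slice i a) (P.slice_subset i a)) (P.convex_slice i a)
  rw [((P.finite_extremePoints_slice i a).isClosed_convexHull ℝ).closure_eq] at hKM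
  have hxs : x ∈ P.slice i a := ⟨ha, hx.2⟩
  rw [← hKM] at hxs
  exact convexHull_mono (Set.subset_biUnion_of_mem (u := fun a => (P.slice i a).extremePoints ℝ)
    haB) hxs

end CoupledMILP

/-! ### Descent with diminishing steps -/

/-- Deterministic supermartingale argument for diminishing step sizes: the Lyapunov sequence
converges, and the gaps are arbitrarily small infinitely often. -/
theorem IsDiminishingStep.tendsto_of_descent {α : ℕ → ℝ} (hα : IsDiminishingStep α)
    {a δ : ℕ → ℝ} {C : ℝ} (ha : ∀ t, 0 ≤ a t) (hδ : ∀ t, 0 ≤ δ t)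
    (h : ∀ t, a (t + 1) ≤ a t - 2 * α t * δ t + C * α t ^ 2) :
    (∃ l, Tendsto a atTop (𝓝 l)) ∧ ∀ ε > 0, ∃ᶠ t in atTop, δ t < ε := by
  set Q : ℕ → ℝ := fun t => ∑ k ∈ Finset.range t, C * α k ^ 2 with hQ
  have hQlim : Tendsto Q atTop (𝓝 (∑' k, C * α k ^ 2)) :=
    (hα.summable_sq.mul_left C).hasSum.tendsto_sum_nat
  have hQs : ∀ t, Q (t + 1) = Q t + C * α t ^ 2 := fun t => Finset.sum_range_succ _ _
  obtain ⟨B, hB⟩ := hQlim.bddAbove_range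
  have hQB : ∀ t, Q t ≤ B := fun t => hB ⟨t, rfl⟩
  constructor
  · have hanti : Antitone fun t => a t - Q t := antitone_nat_of_succ_le fun t => by
      have := h t
      have := mul_nonneg (hα.nonneg t) (hδ t)
      rw [hQs]
      linarith
    have hbdd : BddBelow (Set.range fun t => a t - Q t) :=
      ⟨-B, by rintro _ ⟨t, rfl⟩; linarith [ha t, hQB t]⟩
    refine ⟨_, ((tendsto_atTop_ciInf hanti hbdd).add hQlim).congr fun t => ?_⟩
    ring
  · intro ε hε
    -- Gaps eventually at least `ε` would lower `a - Q` by at least `2 * ε * α t` at each step,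
    -- without bound since `∑ α = ∞`.
    by_contra hfreq
    rw [not_frequently] at hfreq
    obtain ⟨T, hT⟩ := eventually_atTop.1 hfreq
    have hsum : ∀ n, a (T + n) - Q (T + n) + 2 * ε * (∑ t ∈ Finset.range (T + n), α t) ≤
        a T - Q T + 2 * ε * ∑ t ∈ Finset.range T, α t := by
      intro n
      induction n with
      | zero => simp
      | succ n ih =>
        have h1 := h (T + n)
        have h2 : ε ≤ δ (T + n) := not_lt.1 (hT _ (Nat.le_add_right _ _))
        have h3 := mul_le_mul_of_nonneg_left h2 (hα.nonneg (T + n))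
        rw [← add_assoc, hQs, Finset.sum_range_succ]
        linarith
    set R := a T - Q T + 2 * ε * ∑ t ∈ Finset.range T, α t
    obtain ⟨n, hn, hn'⟩ := ((hα.sum_eq_top.eventually_gt_atTop ((R + B) / (2 * ε))).and
      (eventually_ge_atTop T)).exists
    obtain ⟨m, rfl⟩ := Nat.exists_eq_add_of_le hn'
    rw [div_lt_iff₀ (by positivity)] at hn
    linarith [hsum m, ha (T + m), hQB (T + m)]

/-! ### Graph Laplacian and its inverse on zero-sum vectors -/

namespace SimpleGraph

variable {V ι : Type*} [Fintype V] [Fintype ι] [DecidableEq V]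
  (G : SimpleGraph V) [DecidableRel G.Adj]

theorem dotProduct_lapMatrix_mulVec (x : V → ℝ) :
    x ⬝ᵥ (G.lapMatrix ℝ *ᵥ x) = (∑ i, ∑ j, if G.Adj i j then (x i - x j) ^ 2 else 0) / 2 := by
  rw [← lapMatrix_toLinearMap₂', toLinearMap₂'_apply']

theorem lapMatrix_mulVec_apply_eq_sum (x : V → ℝ) (i : V) :
    (G.lapMatrix ℝ *ᵥ x) i = ∑ j ∈ G.neighborFinset i, (x i - x j) := by
  rw [lapMatrix_mulVec_apply, Finset.sum_sub_distrib, Finset.sum_const, nsmul_eq_mul,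
    G.card_neighborFinset_eq_degree]

/-- Cauchy–Schwarz over the neighbours of `i`. With `x = T *ᵥ e` for a right inverse `T`, it shows
that the quadratic form of `T` controls every entry of `e`. -/
theorem lapMatrix_mulVec_apply_sq_le (x : V → ℝ) (i : V) :
    (G.lapMatrix ℝ *ᵥ x) i ^ 2 ≤ 2 * Fintype.card V * (x ⬝ᵥ (G.lapMatrix ℝ *ᵥ x)) := by
  have h1 : (G.lapMatrix ℝ *ᵥ x) i = ∑ j, if G.Adj i j then x i - x j else 0 := by
    rw [lapMatrix_mulVec_apply_eq_sum, ← Finset.sum_filter, G.neighborFinset_eq_filter]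
  have h2 := sq_sum_le_card_mul_sum_sq (s := Finset.univ)
    (f := fun j => if G.Adj i j then x i - x j else 0)
  have h3 : ∑ j, (if G.Adj i j then x i - x j else 0) ^ 2 ≤
      ∑ i, ∑ j, if G.Adj i j then (x i - x j) ^ 2 else 0 := by
    simp only [ite_pow, ne_eq, OfNat.ofNat_ne_zero, not_false_eq_true, zero_pow]
    refine Finset.single_le_sum
      (f := fun i => ∑ j, if G.Adj i j then (x i - x j) ^ 2 else 0) (fun i _ => ?_)
      (Finset.mem_univ i)
    exact Finset.sum_nonneg fun j _ => by split_ifs <;> positivity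
  rw [h1, dotProduct_lapMatrix_mulVec]
  refine h2.trans ?_
  rw [Finset.card_univ, mul_comm (2 : ℝ), mul_assoc, mul_div_cancel₀ _ two_ne_zero]
  gcongr

/-- On a connected graph the Laplacian has a symmetric right inverse on vectors of zero sum. -/
theorem Connected.exists_isSymm_lapMatrix_mulVec_eq (hG : G.Connected) :
    ∃ T : Matrix V V ℝ, T.IsSymm ∧
      ∀ e : V → ℝ, ∑ i, e i = 0 → G.lapMatrix ℝ *ᵥ (T *ᵥ e) = e := by
  have := hG.nonempty
  -- Adding the all-ones matrix removes the constants from the kernel and changes nothing on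
  -- zero-sum vectors, so the inverse of the sum serves as `T`.
  set J : Matrix V V ℝ := of fun _ _ => 1
  set K := G.lapMatrix ℝ + J with hK
  have hJ : ∀ x : V → ℝ, J *ᵥ x = fun _ => ∑ i, x i := fun x => by
    ext i; simp [J, mulVec, dotProduct]
  have hsumL : ∀ x : V → ℝ, ∑ i, (G.lapMatrix ℝ *ᵥ x) i = 0 := fun x => by
    have h1 : (fun _ => (1 : ℝ)) ⬝ᵥ (G.lapMatrix ℝ *ᵥ x) = 0 := by
      rw [dotProduct_mulVec, ← mulVec_transpose, (isSymm_lapMatrix ℝ G).eq,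
        lapMatrix_mulVec_const_eq_zero, zero_dotProduct]
    simpa [dotProduct] using h1
  have hcard : (Fintype.card V : ℝ) ≠ 0 := by exact_mod_cast Fintype.card_ne_zero
  have hsum : ∀ x : V → ℝ, ∑ i, (K *ᵥ x) i = 0 → ∑ i, x i = 0 := fun x hx => by
    simp only [hK, add_mulVec, Pi.add_apply, Finset.sum_add_distrib, hsumL, hJ, zero_add,
      Finset.sum_const, Finset.card_univ, nsmul_eq_mul] at hx
    exact (mul_eq_zero.1 hx).resolve_left hcard
  have hKL : ∀ x : V → ℝ, ∑ i, x i = 0 → K *ᵥ x = G.lapMatrix ℝ *ᵥ x := fun x hx => by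
    ext i
    simp [hK, add_mulVec, hJ, hx]
  have hinj : Function.Injective K.mulVec := by
    rw [← coe_mulVecLin, ← LinearMap.ker_eq_bot, LinearMap.ker_eq_bot']
    intro x hx
    rw [mulVecLin_apply] at hx
    have h0 : ∑ i, x i = 0 := hsum x (by simp [hx])
    rw [hKL x h0, lapMatrix_mulVec_eq_zero_iff_forall_reachable] at hx
    ext i
    have h1 : ∑ j, x j = Fintype.card V * x i := by
      rw [Finset.sum_congr rfl fun j _ => hx j i (hG.preconnected j i)]
      simp
    rw [h0] at h1
    exact (mul_eq_zero.1 h1.symm).resolve_left hcard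
  have hunit : IsUnit K.det := (isUnit_iff_isUnit_det _).1 (mulVec_injective_iff_isUnit.1 hinj)
  refine ⟨K⁻¹, ?_, fun e he => ?_⟩
  · have hKs : K.IsSymm := (isSymm_lapMatrix ℝ G).add (by ext; rfl)
    rw [IsSymm, transpose_nonsing_inv, hKs.eq]
  · have h1 : K *ᵥ (K⁻¹ *ᵥ e) = e := by rw [mulVec_mulVec, mul_nonsing_inv _ hunit, one_mulVec]
    rw [← hKL _ (hsum _ (by rw [h1, he])), h1]

end SimpleGraph

namespace Matrix

variable {V : Type*} [Fintype V] {L T : Matrix V V ℝ}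

theorem dotProduct_mulVec_comm_of_isSymm (hT : T.IsSymm) (x z : V → ℝ) :
    x ⬝ᵥ (T *ᵥ z) = (T *ᵥ x) ⬝ᵥ z := by
  rw [dotProduct_mulVec, ← mulVec_transpose, hT.eq]

/-- Change of the quadratic form of a right inverse `T` of `L` under a step in the range of `L`. -/
theorem quadraticForm_add_smul_mulVec (hL : L.IsSymm) (hT : T.IsSymm) {e : V → ℝ}
    (he : L *ᵥ (T *ᵥ e) = e) (m : V → ℝ) (a : ℝ) :
    (e + a • (L *ᵥ m)) ⬝ᵥ (T *ᵥ (e + a • (L *ᵥ m))) =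
      e ⬝ᵥ (T *ᵥ e) + 2 * a * (m ⬝ᵥ e) + a ^ 2 * ((L *ᵥ m) ⬝ᵥ (T *ᵥ (L *ᵥ m))) := by
  have h1 : (L *ᵥ m) ⬝ᵥ (T *ᵥ e) = m ⬝ᵥ e := by
    rw [← dotProduct_mulVec_comm_of_isSymm hL, he]
  have h2 : e ⬝ᵥ (T *ᵥ (L *ᵥ m)) = m ⬝ᵥ e := by
    rw [dotProduct_mulVec_comm_of_isSymm hT, dotProduct_comm, h1]
  simp only [mulVec_add, mulVec_smul, add_dotProduct, dotProduct_add, smul_dotProduct,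
    dotProduct_smul, h1, h2, smul_eq_mul]
  ring

end Matrix

/-! ### Convergence of the allocations -/

/-- Convergence of the distributed subgradient method
`y i ← y i + α ∑ j ∈ N(i), (μ i - μ j)`, `-μ i ∈ ∂ (f i) (y i)`, for minimising `∑ i, f i (y i)`
subject to `∑ i, y i = B`. -/
theorem SimpleGraph.Connected.tendsto_distributed_subgradient {V ι : Type*} [Fintype V]
    [Fintype ι] [DecidableEq V] {G : SimpleGraph V} [DecidableRel G.Adj] (hG : G.Connected)
    {α : ℕ → ℝ} (hα : IsDiminishingStep α) {y μ : ℕ → V → ι → ℝ} {B : ι → ℝ}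
    {f : V → (ι → ℝ) → ℝ} {M p : ℝ}
    (hinit : ∑ i, y 0 i = B)
    (hstep : ∀ t i, y (t + 1) i = y t i + α t • ∑ j ∈ G.neighborFinset i, (μ t i - μ t j))
    (hμ0 : ∀ t i s, 0 ≤ μ t i s) (hμM : ∀ t i s, μ t i s ≤ M)
    (hsub : ∀ t i x, f i (y t i) ≤ f i x + μ t i ⬝ᵥ (x - y t i))
    (hlsc : ∀ i x, ∃ ν : ι → ℝ, ∀ x', f i x ≤ f i x' + ν ⬝ᵥ (x' - x))
    (hp : ∀ x : V → ι → ℝ, ∑ i, x i = B → p ≤ ∑ i, f i (x i))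
    (hopt : ∃ x : V → ι → ℝ, ∑ i, x i = B ∧ ∑ i, f i (x i) ≤ p) :
    ∃ x : V → ι → ℝ, ∑ i, x i = B ∧ ∑ i, f i (x i) ≤ p ∧ Tendsto y atTop (𝓝 x) := by
  obtain ⟨T, hT, hLT⟩ := hG.exists_isSymm_lapMatrix_mulVec_eq
  have hL : (G.lapMatrix ℝ).IsSymm := SimpleGraph.isSymm_lapMatrix ℝ G
  set L := G.lapMatrix ℝ with hLdef
  -- The update adds `α t • L μ`; measured by the inverse `T` of `L`, its cross term is the plain
  -- pairing of `μ` with `y - x`, to which the subgradient inequality applies.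
  set W : (V → ι → ℝ) → ℝ := fun e => ∑ s, (fun i => e i s) ⬝ᵥ (T *ᵥ fun i => e i s) with hW
  have hWcont : Continuous W := by
    refine continuous_finsetSum _ fun s _ => ?_
    have : Continuous fun e : V → ι → ℝ => fun i => e i s := by fun_prop
    exact this.dotProduct (continuous_const.matrix_mulVec this)
  have hstep' : ∀ t (s : ι), (fun i => y (t + 1) i s) =
      (fun i => y t i s) + α t • (L *ᵥ fun i => μ t i s) := fun t s => by
    ext i
    simp [hstep, SimpleGraph.lapMatrix_mulVec_apply_eq_sum, hLdef, Finset.sum_apply]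
  have hsum : ∀ t, ∑ i, y t i = B := by
    intro t
    induction t with
    | zero => exact hinit
    | succ t ih =>
      rw [← ih]
      ext s
      have h1 : (fun _ => (1 : ℝ)) ⬝ᵥ (L *ᵥ fun i => μ t i s) = 0 := by
        rw [dotProduct_mulVec_comm_of_isSymm hL, SimpleGraph.lapMatrix_mulVec_const_eq_zero,
          zero_dotProduct]
      have h2 := congrArg (fun v => (fun _ => (1 : ℝ)) ⬝ᵥ v) (hstep' t s)
      simp only [dotProduct_add, dotProduct_smul, h1, smul_zero, add_zero] at h2
      simpa [dotProduct, Finset.sum_apply] using h2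
  have hsum0 : ∀ x : V → ι → ℝ, ∑ i, x i = B → ∀ t s, ∑ i, (y t i s - x i s) = 0 := by
    intro x hx t s
    have h1 := congrFun (hsum t) s
    have h2 := congrFun hx s
    simp only [Finset.sum_apply] at h1 h2
    rw [Finset.sum_sub_distrib, h1, h2, sub_self]
  have hterm : ∀ e : V → ℝ, ∑ i, e i = 0 → ∀ i,
      e i ^ 2 ≤ 2 * Fintype.card V * (e ⬝ᵥ (T *ᵥ e)) := by
    intro e he i
    have h1 := G.lapMatrix_mulVec_apply_sq_le (T *ᵥ e) i
    rwa [← hLdef, hLT e he, dotProduct_comm] at h1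
  have := hG.nonempty
  have hcard : (0 : ℝ) < 2 * Fintype.card V := by
    have : (0 : ℝ) < Fintype.card V := by exact_mod_cast Fintype.card_pos
    linarith
  have hterm0 : ∀ e : V → ℝ, ∑ i, e i = 0 → 0 ≤ e ⬝ᵥ (T *ᵥ e) := fun e he =>
    nonneg_of_mul_nonneg_right ((sq_nonneg _).trans (hterm e he (Classical.arbitrary V))) hcard
  have hWnonneg : ∀ x : V → ι → ℝ, ∑ i, x i = B → ∀ t, 0 ≤ W (y t - x) := fun x hx t =>
    Finset.sum_nonneg fun s _ => hterm0 _ (hsum0 x hx t s)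
  have hentry : ∀ x : V → ι → ℝ, ∑ i, x i = B → ∀ t i s,
      (y t i s - x i s) ^ 2 ≤ 2 * Fintype.card V * W (y t - x) := by
    intro x hx t i s
    refine (hterm _ (hsum0 x hx t s) i).trans (mul_le_mul_of_nonneg_left ?_ hcard.le)
    exact Finset.single_le_sum (f := fun s => (fun i => (y t - x) i s) ⬝ᵥ
      (T *ᵥ fun i => (y t - x) i s)) (fun s _ => hterm0 _ (hsum0 x hx t s)) (Finset.mem_univ s)
  obtain ⟨C, hC⟩ : ∃ C, ∀ t,
      ∑ s, (L *ᵥ fun i => μ t i s) ⬝ᵥ (T *ᵥ (L *ᵥ fun i => μ t i s)) ≤ C := by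
    have hcont : Continuous fun m : V → ι → ℝ =>
        ∑ s, (L *ᵥ fun i => m i s) ⬝ᵥ (T *ᵥ (L *ᵥ fun i => m i s)) := by
      refine continuous_finsetSum _ fun s _ => ?_
      have : Continuous fun m : V → ι → ℝ => L *ᵥ fun i => m i s :=
        continuous_const.matrix_mulVec (by fun_prop)
      exact this.dotProduct (continuous_const.matrix_mulVec this)
    obtain ⟨C, hC⟩ := (isCompact_Icc (a := (0 : V → ι → ℝ)) (b := fun _ _ => M)).bddAbove_image
      hcont.continuousOn
    exact ⟨C, fun t => hC ⟨μ t, ⟨fun i s => hμ0 t i s, fun i s => hμM t i s⟩, rfl⟩⟩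
  have hdescent : ∀ x : V → ι → ℝ, ∑ i, x i = B → ∑ i, f i (x i) ≤ p → ∀ t,
      W (y (t + 1) - x) ≤ W (y t - x) - 2 * α t * (∑ i, f i (y t i) - p) + C * α t ^ 2 := by
    intro x hx hfx t
    have h1 : W (y (t + 1) - x) = W (y t - x) +
        2 * α t * (∑ s, (fun i => μ t i s) ⬝ᵥ (fun i => y t i s - x i s)) + α t ^ 2 *
          ∑ s, (L *ᵥ fun i => μ t i s) ⬝ᵥ (T *ᵥ (L *ᵥ fun i => μ t i s)) := by
      simp only [hW, Finset.mul_sum, ← Finset.sum_add_distrib]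
      refine Finset.sum_congr rfl fun s _ => ?_
      refine Eq.trans ?_ (quadraticForm_add_smul_mulVec hL hT (hLT _ (hsum0 x hx t s))
        (fun i => μ t i s) (α t))
      have h2 : (fun i => (y (t + 1) - x) i s) =
          (fun i => y t i s - x i s) + α t • (L *ᵥ fun i => μ t i s) := by
        ext i
        have := congrFun (hstep' t s) i
        simp only [Pi.add_apply, Pi.sub_apply] at this ⊢
        rw [this]
        ring
      rw [h2]
    have h3 : ∑ s, (fun i => μ t i s) ⬝ᵥ (fun i => y t i s - x i s) =
        -∑ i, μ t i ⬝ᵥ (x i - y t i) := by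
      simp only [dotProduct, Pi.sub_apply, ← Finset.sum_neg_distrib]
      rw [Finset.sum_comm]
      exact Finset.sum_congr rfl fun i _ => Finset.sum_congr rfl fun s _ => by ring
    have h4 : ∑ i, f i (y t i) ≤ ∑ i, f i (x i) + ∑ i, μ t i ⬝ᵥ (x i - y t i) := by
      rw [← Finset.sum_add_distrib]
      exact Finset.sum_le_sum fun i _ => hsub t i (x i)
    have h5 := mul_le_mul_of_nonneg_left (hC t) (sq_nonneg (α t))
    have h6 : α t * (-∑ i, μ t i ⬝ᵥ (x i - y t i)) ≤ α t * (p - ∑ i, f i (y t i)) :=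
      mul_le_mul_of_nonneg_left (by linarith) (hα.nonneg t)
    rw [h1, h3]
    linarith
  have hconv : ∀ x : V → ι → ℝ, ∑ i, x i = B → ∑ i, f i (x i) ≤ p →
      (∃ l, Tendsto (fun t => W (y t - x)) atTop (𝓝 l)) ∧
        ∀ ε > 0, ∃ᶠ t in atTop, ∑ i, f i (y t i) - p < ε := fun x hx hfx =>
    hα.tendsto_of_descent (hWnonneg x hx) (fun t => sub_nonneg.2 (hp _ (hsum t)))
      (hdescent x hx hfx)
  obtain ⟨x₀, hx₀, hfx₀⟩ := hopt
  obtain ⟨⟨l₀, hl₀⟩, hfreq⟩ := hconv x₀ hx₀ hfx₀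
  obtain ⟨φ, hφ, hφlt⟩ := extraction_forall_of_frequently
    (P := fun n t => ∑ i, f i (y t i) - p < 1 / ((n : ℝ) + 1))
    fun n => hfreq _ (by positivity)
  obtain ⟨R, hR⟩ : ∃ R, ∀ t i s, |y t i s - x₀ i s| ≤ R := by
    obtain ⟨b, hb⟩ := hl₀.bddAbove_range
    refine ⟨√(2 * Fintype.card V * b), fun t i s => Real.abs_le_sqrt ?_⟩
    exact (hentry x₀ hx₀ t i s).trans (mul_le_mul_of_nonneg_left (hb ⟨t, rfl⟩) hcard.le)
  obtain ⟨x, -, ψ, hψ, hlim⟩ := (isCompact_Icc (a := fun i s => x₀ i s - R)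
    (b := fun i s => x₀ i s + R)).tendsto_subseq (x := fun n => y (φ n)) fun n =>
      ⟨fun i s => by have := (abs_le.1 (hR (φ n) i s)).1; linarith,
        fun i s => by have := (abs_le.1 (hR (φ n) i s)).2; linarith⟩
  have hx : ∑ i, x i = B := by
    have hc : Continuous fun z : V → ι → ℝ => ∑ i, z i := by fun_prop
    have h1 := (hc.tendsto x).comp hlim
    refine tendsto_nhds_unique h1 (tendsto_const_nhds.congr fun n => ?_)
    exact (hsum _).symm
  have hfx : ∑ i, f i (x i) ≤ p := by
    choose ν hν using fun i => hlsc i (x i)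
    have hc : Continuous fun z : V → ι → ℝ => ∑ i, ν i ⬝ᵥ (z i - x i) :=
      continuous_finsetSum _ fun i _ => continuous_const.dotProduct (by fun_prop)
    have h1 := (hc.tendsto x).comp hlim
    simp only [sub_self, dotProduct_zero, Finset.sum_const_zero] at h1
    have h2 := ((tendsto_one_div_add_atTop_nhds_zero_nat (𝕜 := ℝ)).comp
      hψ.tendsto_atTop).add h1 |>.const_add p
    simp only [add_zero] at h2
    refine ge_of_tendsto' h2 fun n => ?_
    have h3 := hφlt (ψ n)
    have h4 : ∑ i, f i (x i) ≤ ∑ i, f i (y (φ (ψ n)) i) +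
        ∑ i, ν i ⬝ᵥ (y (φ (ψ n)) i - x i) := by
      rw [← Finset.sum_add_distrib]
      exact Finset.sum_le_sum fun i _ => hν i _
    simp only [Function.comp_apply]
    linarith
  refine ⟨x, hx, hfx, ?_⟩
  obtain ⟨⟨l, hl⟩, -⟩ := hconv x hx hfx
  -- The distance to the minimiser `x` converges along the whole sequence and vanishes along a
  -- subsequence.
  have hl0 : l = 0 := by
    have h1 := hl.comp (hφ.comp hψ).tendsto_atTop
    have hc : Continuous fun z : V → ι → ℝ => W (z - x) :=
      hWcont.comp (continuous_id.sub continuous_const)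
    have h2 := (hc.tendsto x).comp hlim
    have h3 := tendsto_nhds_unique h1 h2
    rw [h3, sub_self]
    simp [hW]
  rw [hl0] at hl
  refine tendsto_pi_nhds.2 fun i => tendsto_pi_nhds.2 fun s => ?_
  have h1 := (hl.const_mul (2 * (Fintype.card V : ℝ))).sqrt
  rw [mul_zero, Real.sqrt_zero] at h1
  rw [tendsto_iff_dist_tendsto_zero]
  refine squeeze_zero (fun _ => dist_nonneg) (fun t => ?_) h1
  rw [Real.dist_eq]
  exact Real.abs_le_sqrt (hentry x hx t i s)

/-! ### Few fractional components at a unique optimum -/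

/-- A non-extreme point of a convex set is the midpoint of a nondegenerate segment in the set. -/
theorem Convex.exists_ne_zero_add_sub_mem {E : Type*} [AddCommGroup E] [Module ℝ E] {K : Set E}
    (hK : Convex ℝ K) {z : E} (hz : z ∈ K) (hext : z ∉ K.extremePoints ℝ) :
    ∃ d : E, d ≠ 0 ∧ z + d ∈ K ∧ z - d ∈ K := by
  simp only [mem_extremePoints_iff_left, not_and, not_forall] at hext
  obtain ⟨x₁, hx₁, x₂, hx₂, ⟨a, b, ha, hb, hab, rfl⟩, hne⟩ := hext hz
  have hm : 0 < min a b := lt_min ha hb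
  refine ⟨min a b • (x₁ - x₂), smul_ne_zero hm.ne' fun h => hne ?_, ?_, ?_⟩
  · rw [← sub_eq_zero.1 h, ← add_smul, hab, one_smul]
  · have := hK hx₁ hx₂ (a := a + min a b) (b := b - min a b) (by positivity)
      (sub_nonneg.2 (min_le_right a b)) (by linarith)
    convert this using 1
    module
  · have := hK hx₁ hx₂ (a := a - min a b) (b := b + min a b) (sub_nonneg.2 (min_le_left a b))
      (by positivity) (by linarith)
    convert this using 1
    module

theorem Convex.add_smul_mem_of_abs_le_one {E : Type*} [AddCommGroup E] [Module ℝ E] {K : Set E}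
    (hK : Convex ℝ K) {z d : E} (h1 : z + d ∈ K) (h2 : z - d ∈ K) {r : ℝ} (hr : |r| ≤ 1) :
    z + r • d ∈ K := by
  obtain ⟨hr1, hr2⟩ := abs_le.1 hr
  have := hK h1 h2 (a := (1 + r) / 2) (b := (1 - r) / 2) (by linarith) (by linarith) (by ring)
  convert this using 1
  module

namespace CoupledMILP

variable {N S : ℕ} (P : CoupledMILP N S)

/-- If the relaxed linear program has a unique solution, then all but at most `S + 1` of its
components are mixed-integer. -/
theorem card_notMem_X_le {σ : Fin S → ℝ} {z : (i : Fin N) → P.Var i} (hz : P.IsLPOptimal σ z)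
    (huniq : ∀ z', P.IsLPOptimal σ z' → z' = z) (bad : Finset (Fin N))
    (hbad : ∀ i ∈ bad, z i ∉ P.X i) : bad.card ≤ S + 1 := by
  classical
  by_contra! hcard
  have hd : ∀ i, ∃ d : P.Var i, (i ∈ bad → d ≠ 0) ∧ z i + d ∈ convexHull ℝ (P.X i) ∧
      z i - d ∈ convexHull ℝ (P.X i) := fun i => by
    by_cases hi : i ∈ bad
    · obtain ⟨d, hd0, hd⟩ := (convex_convexHull ℝ (P.X i)).exists_ne_zero_add_sub_mem (hz.1.1 i)
        fun h => hbad i hi (extremePoints_convexHull_subset h)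
      exact ⟨d, fun _ => hd0, hd⟩
    · exact ⟨0, fun h => absurd h hi, by simpa using hz.1.1 i, by simpa using hz.1.1 i⟩
  choose d hd0 hdadd hdsub using hd
  have hdep : ¬ LinearIndepOn ℝ
      (fun i => ((P.c i ⬝ᵥ d i, P.A i *ᵥ d i) : ℝ × (Fin S → ℝ))) (bad : Set (Fin N)) := fun h => by
    have h1 := LinearIndependent.fintype_card_le_finrank h
    simp only [Module.finrank_prod, Module.finrank_self, Module.finrank_fin_fun] at h1
    have h2 : Fintype.card (bad : Set (Fin N)) = bad.card := by simp
    omega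
  rw [not_linearIndepOn_finset_iff] at hdep
  obtain ⟨g, hg, i₀, hi₀, hgi₀⟩ := hdep
  -- Dividing the dependence by `m` keeps every coefficient in `[-1, 1]`, so moving by `r i • d i`
  -- stays in the hulls.
  set m := ∑ i ∈ bad, |g i| with hm
  have hmle : ∀ i ∈ bad, |g i| ≤ m := fun i hi =>
    Finset.single_le_sum (f := fun i => |g i|) (fun i _ => abs_nonneg _) hi
  have hmpos : 0 < m := (abs_pos.2 hgi₀).trans_le (hmle i₀ hi₀)
  set r : Fin N → ℝ := fun i => if i ∈ bad then m⁻¹ * g i else 0 with hr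
  have hr1 : ∀ i, |r i| ≤ 1 := fun i => by
    by_cases hi : i ∈ bad
    · simp only [hr, hi, if_true]
      rw [abs_mul, abs_inv, abs_of_pos hmpos, inv_mul_le_iff₀ hmpos, mul_one]
      exact hmle i hi
    · simp [hr, hi]
  have hrsum : ∑ i, r i • ((P.c i ⬝ᵥ d i, P.A i *ᵥ d i) : ℝ × (Fin S → ℝ)) = 0 := by
    have : ∑ i, r i • ((P.c i ⬝ᵥ d i, P.A i *ᵥ d i) : ℝ × (Fin S → ℝ)) =
        m⁻¹ • ∑ i ∈ bad, g i • ((P.c i ⬝ᵥ d i, P.A i *ᵥ d i) : ℝ × (Fin S → ℝ)) := by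
      rw [Finset.smul_sum, ← Finset.sum_subset (Finset.subset_univ bad)]
      · exact Finset.sum_congr rfl fun i hi => by
          simp only [hr, hi, if_true]
          rw [smul_smul]
      · intro i _ hi
        simp [hr, hi]
    rw [this, hg, smul_zero]
  have hrc : ∑ i, r i * (P.c i ⬝ᵥ d i) = 0 := by
    simpa [Prod.fst_sum] using congrArg Prod.fst hrsum
  have hrA : ∑ i, r i • (P.A i *ᵥ d i) = 0 := by
    simpa [Prod.snd_sum] using congrArg Prod.snd hrsum
  have hz' : P.IsLPOptimal σ fun i => z i + r i • d i := by
    refine ⟨⟨fun i => (convex_convexHull ℝ _).add_smul_mem_of_abs_le_one (hdadd i) (hdsub i)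
      (hr1 i), ?_⟩, fun z' hz' => ?_⟩
    · simp only [mulVec_add, mulVec_smul, Finset.sum_add_distrib, hrA, add_zero]
      exact hz.1.2
    · simp only [dotProduct_add, dotProduct_smul, smul_eq_mul, Finset.sum_add_distrib, hrc,
        add_zero]
      exact hz.2 z' hz'
  have h1 := congrFun (huniq _ hz') i₀
  simp only [add_eq_left, smul_eq_zero, hr, hi₀, if_true, mul_eq_zero, inv_eq_zero, hmpos.ne',
    hgi₀, false_or] at h1
  exact hd0 i₀ hi₀ h1

/-! ### Local duality and exact penalisation -/

theorem isCompact_convexHull_X {i : Fin N} (hc : IsCompact (P.X i)) :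
    IsCompact (convexHull ℝ (P.X i)) := by
  obtain ⟨V, hV, hVX⟩ := P.exists_finite_convexHull_eq hc
  exact hVX ▸ hV.isCompact_convexHull ℝ

/-- The relaxed local linear program has an optimal solution. -/
theorem exists_local_value {i : Fin N} (hne : (P.X i).Nonempty) (hc : IsCompact (P.X i))
    {M : ℝ} (hM : 0 ≤ M) (y : Fin S → ℝ) :
    ∃ r : ℝ, (∃ z ∈ convexHull ℝ (P.X i), ∃ v : ℝ, 0 ≤ v ∧ P.A i *ᵥ z ≤ (y + fun _ => v) ∧
        P.c i ⬝ᵥ z + M * v = r) ∧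
      ∀ z ∈ convexHull ℝ (P.X i), ∀ v : ℝ, 0 ≤ v → P.A i *ᵥ z ≤ (y + fun _ => v) →
        r ≤ P.c i ⬝ᵥ z + M * v := by
  -- For fixed `z` the cheapest `v` is the sup norm of the positive part of the violation, so only
  -- `z` in a compact set remains.
  have hcont : Continuous fun z : P.Var i => P.c i ⬝ᵥ z + M * ‖fun s => max ((P.A i *ᵥ z) s - y s) 0‖ := by
    have h1 : Continuous fun z : P.Var i => P.A i *ᵥ z :=
      continuous_const.matrix_mulVec continuous_id
    have h2 : Continuous fun z : P.Var i => P.c i ⬝ᵥ z :=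
      continuous_const.dotProduct continuous_id
    have h3 : Continuous fun z : P.Var i => fun s => max ((P.A i *ᵥ z) s - y s) 0 :=
      continuous_pi fun s => (((continuous_apply s).comp h1).sub continuous_const).max
        continuous_const
    exact h2.add (continuous_const.mul h3.norm)
  obtain ⟨z, hz, hmin⟩ := (P.isCompact_convexHull_X hc).exists_isMinOn hne.convexHull
    hcont.continuousOn
  refine ⟨_, ⟨z, hz, ‖fun s => max ((P.A i *ᵥ z) s - y s) 0‖, norm_nonneg _, fun s => ?_, rfl⟩, ?_⟩
  · have h1 := (le_abs_self _).trans
      (norm_le_pi_norm (fun s => max ((P.A i *ᵥ z) s - y s) 0) s)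
    have h2 := (le_max_left _ _).trans h1
    simp only [Pi.add_apply]
    linarith
  · intro z' hz' v hv hle
    refine (hmin hz').trans ?_
    have : ‖fun s => max ((P.A i *ᵥ z') s - y s) 0‖ ≤ v :=
      (pi_norm_le_iff_of_nonneg hv).2 fun s => by
        have h1 := hle s
        rw [Real.norm_of_nonneg (le_max_right _ _)]
        simp only [Pi.add_apply] at h1
        exact max_le (by linarith) hv
    have := mul_le_mul_of_nonneg_left this hM
    linarith

/-- Isolates `v`: bounded below over `v ≥ 0` exactly when `∑ s, μ s ≤ M`. -/
theorem lagrangian_eq (i : Fin N) (M : ℝ) (y μ : Fin S → ℝ) (z : P.Var i) (v : ℝ) :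
    P.lagrangian i M y μ z v =
      P.c i ⬝ᵥ z + μ ⬝ᵥ (P.A i *ᵥ z - y) + v * (M - ∑ s, μ s) := by
  have : μ ⬝ᵥ (fun _ => v) = (∑ s, μ s) * v := by
    simp [dotProduct, Finset.sum_mul]
  rw [lagrangian, ← sub_sub, dotProduct_sub, this]
  ring

/-- The variable `v`, of cost `M` and constraint column `-1`, is what caps the total of the
multiplier by `M`. -/
theorem exists_local_multiplier {i : Fin N} (hc : IsCompact (P.X i)) {M : ℝ} (hM : 0 ≤ M)
    {y : Fin S → ℝ} {r : ℝ}
    (hr : ∀ z ∈ convexHull ℝ (P.X i), ∀ v : ℝ, 0 ≤ v → P.A i *ᵥ z ≤ (y + fun _ => v) →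
      r ≤ P.c i ⬝ᵥ z + M * v) :
    ∃ μ : Fin S → ℝ, 0 ≤ μ ∧ ∑ s, μ s ≤ M ∧
      ∀ z ∈ convexHull ℝ (P.X i), r ≤ P.c i ⬝ᵥ z + μ ⬝ᵥ (P.A i *ᵥ z - y) := by
  obtain ⟨V, hV, hVX⟩ := P.exists_finite_convexHull_eq hc
  rw [hVX] at hr ⊢
  obtain ⟨μ, hμ0, hμM, hμ⟩ := exists_multiplier_convexHull hV (dotProductBilin ℝ ℝ (P.c i))
    (P.A i).mulVecLin y (fun _ => -1) r M (fun v hv _ => mul_nonneg hv hM) fun z hz v hv hle => by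
      have := hr z hz v hv fun s => by
        have := hle s
        simp only [Pi.add_apply, Pi.smul_apply, smul_eq_mul, mulVecLin_apply] at this ⊢
        linarith
      simpa [mul_comm] using this
  refine ⟨μ, hμ0, ?_, fun z hz => by simpa using hμ z hz⟩
  have : μ ⬝ᵥ (fun _ => (-1 : ℝ)) = -∑ s, μ s := by simp [dotProduct]
  rw [this] at hμM
  linarith

/-- Strong duality for the relaxed local linear program. -/
theorem IsDualOptimal.sum_le_and_le {i : Fin N} (hne : (P.X i).Nonempty) (hc : IsCompact (P.X i))
    {M : ℝ} (hM : 0 ≤ M) {y μ : Fin S → ℝ} (hμ : P.IsDualOptimal i M y μ) {r : ℝ}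
    (hr : ∀ z ∈ convexHull ℝ (P.X i), ∀ v : ℝ, 0 ≤ v → P.A i *ᵥ z ≤ (y + fun _ => v) →
      r ≤ P.c i ⬝ᵥ z + M * v) :
    ∑ s, μ s ≤ M ∧
      ∀ z ∈ convexHull ℝ (P.X i), r ≤ P.c i ⬝ᵥ z + μ ⬝ᵥ (P.A i *ᵥ z - y) := by
  obtain ⟨μ', hμ'0, hμ'M, hμ'⟩ := P.exists_local_multiplier hc hM hr
  have h1 : (r : EReal) ≤ P.dualFunction i M y μ' := by
    refine le_iInf₂ fun z hz => le_iInf₂ fun v hv => EReal.coe_le_coe_iff.2 ?_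
    rw [lagrangian_eq]
    have := hμ' z hz
    have := mul_nonneg (Set.mem_Ici.1 hv) (sub_nonneg.2 hμ'M)
    linarith
  have h2 : ∀ z ∈ convexHull ℝ (P.X i), ∀ v : ℝ, 0 ≤ v →
      r ≤ P.c i ⬝ᵥ z + μ ⬝ᵥ (P.A i *ᵥ z - y) + v * (M - ∑ s, μ s) := fun z hz v hv => by
    rw [← lagrangian_eq]
    exact EReal.coe_le_coe_iff.1 ((h1.trans (hμ.2 μ' hμ'0)).trans
      ((iInf₂_le z hz).trans (iInf₂_le v hv)))
  refine ⟨?_, fun z hz => by simpa using h2 z hz 0 le_rfl⟩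
  by_contra! hlt
  obtain ⟨z, hz⟩ := hne.convexHull (𝕜 := ℝ)
  set a := P.c i ⬝ᵥ z + μ ⬝ᵥ (P.A i *ᵥ z - y)
  have ha : r ≤ a := by simpa only [zero_mul, add_zero] using h2 z hz 0 le_rfl
  have hpos : 0 < ∑ s, μ s - M := sub_pos.2 hlt
  -- This `v` turns the bound into `r ≤ r - 1`.
  have h3 := h2 z hz ((a - r + 1) / (∑ s, μ s - M)) (div_nonneg (by linarith) hpos.le)
  have h4 : (a - r + 1) / (∑ s, μ s - M) * (M - ∑ s, μ s) = -(a - r + 1) := by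
    rw [← neg_sub (∑ s, μ s) M, mul_neg, div_mul_cancel₀ _ hpos.ne']
  linarith

/-- Exact penalisation: a multiplier for the coupling constraint of the restricted program. -/
theorem exists_coupling_multiplier (hcpt : ∀ i, IsCompact (P.X i)) {σ : Fin S → ℝ}
    {z : (i : Fin N) → P.Var i} (hz : P.IsLPOptimal σ z) :
    ∃ ν : Fin S → ℝ, 0 ≤ ν ∧ ∀ z' : (i : Fin N) → P.Var i,
      (∀ i, z' i ∈ convexHull ℝ (P.X i)) →
        ∑ i, P.c i ⬝ᵥ z i ≤ ∑ i, P.c i ⬝ᵥ z' i + ν ⬝ᵥ (∑ i, P.A i *ᵥ z' i - (P.b - σ)) := by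
  choose V hV hVX using fun i => P.exists_finite_convexHull_eq (hcpt i)
  have hpi : ∀ z' : (i : Fin N) → P.Var i, z' ∈ convexHull ℝ (Set.pi Set.univ V) ↔
      ∀ i, z' i ∈ convexHull ℝ (P.X i) := fun z' => by
    simp [convexHull_pi, hVX]
  obtain ⟨ν, hν0, -, hν⟩ := exists_multiplier_convexHull (Set.Finite.pi' hV |> fun h => by
      simpa [Set.pi] using h : (Set.pi Set.univ V).Finite)
    (∑ i, (dotProductBilin ℝ ℝ (P.c i)) ∘ₗ LinearMap.proj i)
    (∑ i, (P.A i).mulVecLin ∘ₗ LinearMap.proj i) (P.b - σ) 0 (∑ i, P.c i ⬝ᵥ z i) 0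
    (fun v _ _ => by simp) fun z' hz' v _ hle => by
      have := hz.2 z' ⟨(hpi z').1 hz', by simpa [LinearMap.sum_apply] using hle⟩
      simpa [LinearMap.sum_apply] using this
  exact ⟨ν, hν0, fun z' hz' => by
    simpa [LinearMap.sum_apply] using hν z' ((hpi z').2 hz')⟩

/-! ### Recovery of a feasible mixed-integer point -/

theorem lowerBound_le {i : Fin N} (hc : IsCompact (P.X i)) {z : P.Var i}
    (hz : z ∈ convexHull ℝ (P.X i)) (s : Fin S) : P.lowerBound i s ≤ (P.A i *ᵥ z) s := by
  have hcont : Continuous fun x : P.Var i => (P.A i *ᵥ x) s :=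
    (continuous_apply s).comp (continuous_const.matrix_mulVec continuous_id)
  have hconv : Convex ℝ {x : P.Var i | P.lowerBound i s ≤ (P.A i *ᵥ x) s} :=
    convex_halfSpace_ge (f := fun x : P.Var i => (P.A i *ᵥ x) s)
      ⟨fun x y => by simp [mulVec_add], fun a x => by simp [mulVec_smul]⟩ _
  exact convexHull_min (fun x hx => csInf_le (hc.bddBelow_image hcont.continuousOn)
    ⟨x, hx, rfl⟩) hconv hz

theorem IsLexOptimal.le_of_mem {i : Fin N} {y : Fin S → ℝ} {ρ ξ ρ' : ℝ} {x x' : P.Var i}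
    (h : P.IsLexOptimal i y ρ ξ x) (hx' : x' ∈ P.X i) (hρ' : 0 ≤ ρ')
    (hle : P.A i *ᵥ x' ≤ (y + fun _ => ρ')) : ρ ≤ ρ' := by
  have := h.2 (ρ', P.c i ⬝ᵥ x', x') ⟨le_rfl, hle, hx', hρ'⟩
  rw [Prod.Lex.toLex_le_toLex] at this
  rcases this with h1 | h1
  exacts [h1.le, h1.1.le]

/-- Local lexicographic optimisation recovers a feasible point from allocations that dominate the
resources used by a relaxed solution with at most `S + 1` components that are not mixed-integer. -/
theorem isFeasible_of_isLexOptimal (hcpt : ∀ i, IsCompact (P.X i))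
    {xL : (i : Fin N) → P.Var i} (hxL : ∀ i, xL i ∈ P.X i) {y : Fin N → Fin S → ℝ}
    (hsum : ∑ i, y i = P.b - fun _ => P.sigmaASY xL) {z : (i : Fin N) → P.Var i}
    (hz : ∀ i, z i ∈ convexHull ℝ (P.X i)) (hzy : ∀ i, P.A i *ᵥ z i ≤ y i)
    (hcard : ∀ bad : Finset (Fin N), (∀ i ∈ bad, z i ∉ P.X i) → bad.card ≤ S + 1)
    {ρ ξ : Fin N → ℝ} {x : (i : Fin N) → P.Var i}
    (hx : ∀ i, P.IsLexOptimal i (y i) (ρ i) (ξ i) (x i)) : P.IsFeasible x := by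
  classical
  refine ⟨fun i => (hx i).1.2.2.1, fun s => ?_⟩
  set Δ := ⨆ i, ⨆ s, ((P.A i *ᵥ xL i) s - P.lowerBound i s) with hΔ
  have hle : ∀ i s, (P.A i *ᵥ xL i) s - P.lowerBound i s ≤ Δ := fun i s =>
    (le_ciSup (f := fun s => (P.A i *ᵥ xL i) s - P.lowerBound i s)
      (Set.finite_range _).bddAbove s).trans
      (le_ciSup (f := fun i => ⨆ s, ((P.A i *ᵥ xL i) s - P.lowerBound i s))
      (Set.finite_range _).bddAbove i)
  have hΔ0 : 0 ≤ Δ := Real.iSup_nonneg fun i => Real.iSup_nonneg fun s =>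
    sub_nonneg.2 (P.lowerBound_le (hcpt i) (subset_convexHull ℝ _ (hxL i)) s)
  set bad : Finset (Fin N) := Finset.univ.filter fun i => z i ∉ P.X i with hbad
  have hρ : ∀ i, ρ i ≤ if z i ∉ P.X i then Δ else 0 := fun i => by
    by_cases h : z i ∈ P.X i
    · rw [if_neg (not_not.2 h)]
      exact (hx i).le_of_mem P h le_rfl fun s => by simpa using hzy i s
    · rw [if_pos h]
      -- `xL i` exceeds the lower bound by at most `Δ` in each row, and `z i`, hence `y i`, lies
      -- above that bound.
      refine (hx i).le_of_mem P (hxL i) hΔ0 fun s => ?_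
      have h1 := hle i s
      have h2 := P.lowerBound_le (hcpt i) (hz i) s
      have h3 := hzy i s
      simp only [Pi.add_apply]
      linarith
  have h1 : (∑ i, P.A i *ᵥ x i) s ≤ ∑ i, y i s + ∑ i, ρ i := by
    rw [Finset.sum_apply, ← Finset.sum_add_distrib]
    exact Finset.sum_le_sum fun i _ => (hx i).1.2.1 s
  have h2 : ∑ i, ρ i ≤ bad.card * Δ := by
    refine (Finset.sum_le_sum fun i _ => hρ i).trans ?_
    rw [← Finset.sum_filter, Finset.sum_const, nsmul_eq_mul]
  have h3 : (bad.card : ℝ) ≤ S + 1 := by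
    exact_mod_cast hcard bad fun i hi => (Finset.mem_filter.1 hi).2
  have h4 := mul_le_mul_of_nonneg_right h3 hΔ0
  have h5 := congrFun hsum s
  simp only [Finset.sum_apply, Pi.sub_apply, sigmaASY, ← hΔ] at h5
  linarith

end CoupledMILP

/-! ### Assembly -/

theorem theorem1 {N S : ℕ} (P : CoupledMILP N S)
    (hne : ∀ i, (P.X i).Nonempty) (hcpt : ∀ i, IsCompact (P.X i))
    (xL : (i : Fin N) → P.Var i) (ell : Fin N → ℝ)
    (hxL : ∀ i, P.IsLowest i (xL i) (ell i))
    (hLP : P.LPUniquelySolvable (fun _ => P.sigmaASY xL)) :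
    ∃ M₀ : ℝ, 0 < M₀ ∧ ∀ M : ℝ, M₀ ≤ M →
      ∀ (G : SimpleGraph (Fin N)) [DecidableRel G.Adj], G.Connected →
      ∀ α : ℕ → ℝ, IsDiminishingStep α →
      ∀ y μ : ℕ → Fin N → Fin S → ℝ, P.IsRun G M α (fun _ => P.sigmaASY xL) y μ →
        ∃ yInf : Fin N → Fin S → ℝ,
          (∀ i, Filter.Tendsto (fun t => y t i) Filter.atTop (nhds (yInf i))) ∧
          ∀ (ρ ξ : Fin N → ℝ) (x : (i : Fin N) → P.Var i),
            (∀ i, P.IsLexOptimal i (yInf i) (ρ i) (ξ i) (x i)) → P.IsFeasible x := by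
  classical
  obtain ⟨-, z, hz, huniq⟩ := hLP
  obtain ⟨ν, hν0, hν⟩ := P.exists_coupling_multiplier hcpt hz
  set B := P.b - fun _ => P.sigmaASY xL with hB
  have hνsum : 0 ≤ ∑ s, ν s := Finset.sum_nonneg fun s _ => hν0 s
  -- The extra `1` leaves the term `∑ i, v i` in `hpen`, which forces `v = 0` at the limit.
  refine ⟨1 + ∑ s, ν s, by linarith, fun M hM G _ hG α hα y μ hrun => ?_⟩
  have hM0 : 0 ≤ M := by linarith
  have hpen : ∀ (w : Fin N → Fin S → ℝ), ∑ i, w i = B → ∀ (z' : (i : Fin N) → P.Var i)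
      (v : Fin N → ℝ), (∀ i, z' i ∈ convexHull ℝ (P.X i)) → (∀ i, 0 ≤ v i) →
      (∀ i, P.A i *ᵥ z' i ≤ (w i + fun _ => v i)) →
      ∑ i, P.c i ⬝ᵥ z i + ∑ i, v i ≤ ∑ i, (P.c i ⬝ᵥ z' i + M * v i) := by
    intro w hw z' v hz' hv hle
    have hvsum : 0 ≤ ∑ i, v i := Finset.sum_nonneg fun i _ => hv i
    have h1 : ν ⬝ᵥ (∑ i, P.A i *ᵥ z' i - B) ≤ (∑ s, ν s) * ∑ i, v i := by
      rw [dotProduct, Finset.sum_mul]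
      refine Finset.sum_le_sum fun s _ => mul_le_mul_of_nonneg_left ?_ (hν0 s)
      rw [← hw, Pi.sub_apply, Finset.sum_apply, Finset.sum_apply, ← Finset.sum_sub_distrib]
      refine Finset.sum_le_sum fun i _ => ?_
      have := hle i s
      simp only [Pi.add_apply] at this
      linarith
    have h2 := hν z' hz'
    have h3 := mul_le_mul_of_nonneg_right hM hvsum
    rw [Finset.sum_add_distrib, ← Finset.mul_sum]
    linarith
  choose f hfatt hfle using fun i => P.exists_local_value (hne i) (hcpt i) hM0
  have hdual := fun t i => (hrun.dual t i).sum_le_and_le P (hne i) (hcpt i) hM0 (hfle i (y t i))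
  -- The violation `v` at `x'` costs `M * v`, which covers its weight `(∑ s, m s) * v` in the
  -- pairing with `m`.
  have hsubgrad : ∀ i (x x' m : Fin S → ℝ), 0 ≤ m → ∑ s, m s ≤ M →
      (∀ z ∈ convexHull ℝ (P.X i), f i x ≤ P.c i ⬝ᵥ z + m ⬝ᵥ (P.A i *ᵥ z - x)) →
      f i x ≤ f i x' + m ⬝ᵥ (x' - x) := by
    intro i x x' m hm0 hmM hm
    obtain ⟨z', hz', v, hv, hle, hval⟩ := hfatt i x'
    have h1 : m ⬝ᵥ (P.A i *ᵥ z' - x) ≤ m ⬝ᵥ (x' - x) + (∑ s, m s) * v := by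
      rw [dotProduct, dotProduct, Finset.sum_mul, ← Finset.sum_add_distrib]
      refine Finset.sum_le_sum fun s _ => ?_
      rw [← mul_add]
      refine mul_le_mul_of_nonneg_left ?_ (hm0 s)
      have := hle s
      simp only [Pi.add_apply, Pi.sub_apply] at this ⊢
      linarith
    have h2 := mul_le_mul_of_nonneg_right hmM hv
    have h3 := hm z' hz'
    linarith
  obtain ⟨yInf, hysum, hyval, hylim⟩ := hG.tendsto_distributed_subgradient hα (f := f) (M := M)
    (p := ∑ i, P.c i ⬝ᵥ z i) hrun.init hrun.step (fun t i s => (hrun.dual t i).1 s)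
    (fun t i s => (Finset.single_le_sum (f := fun s => μ t i s)
      (fun s _ => (hrun.dual t i).1 s) (Finset.mem_univ s)).trans (hdual t i).1)
    (fun t i x => hsubgrad i _ x _ (hrun.dual t i).1 (hdual t i).1 (hdual t i).2)
    (fun i x => by
      obtain ⟨m, hm0, hmM, hm⟩ := P.exists_local_multiplier (hcpt i) hM0 (hfle i x)
      exact ⟨m, fun x' => hsubgrad i x x' m hm0 hmM hm⟩)
    (fun w hw => by
      choose z' hz' v hv hle hval using fun i => hfatt i (w i)
      have h1 := hpen w hw z' v hz' hv hle
      have h2 : 0 ≤ ∑ i, v i := Finset.sum_nonneg fun i _ => hv i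
      simp only [hval] at h1
      linarith)
    (by
      obtain ⟨i₀⟩ := hG.nonempty
      -- Allocations must sum to `B` exactly, so one agent receives all unused resources.
      set slack := B - ∑ i, P.A i *ᵥ z i with hslack
      have hslack0 : 0 ≤ slack := sub_nonneg.2 hz.1.2
      refine ⟨fun i => P.A i *ᵥ z i + if i = i₀ then slack else 0, ?_,
        Finset.sum_le_sum fun i _ => ?_⟩
      · rw [Finset.sum_add_distrib, Finset.sum_ite_eq' Finset.univ i₀, if_pos (Finset.mem_univ _),
          hslack, add_sub_cancel]
      · have h1 := hfle i (P.A i *ᵥ z i + if i = i₀ then slack else 0) (z i) (hz.1.1 i) 0 le_rfl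
          fun s => by
            have : 0 ≤ (if i = i₀ then slack else 0) s := by
              split_ifs
              exacts [hslack0 s, le_rfl]
            simp only [Pi.add_apply]
            linarith
        simpa using h1)
  refine ⟨yInf, fun i => tendsto_pi_nhds.1 hylim i, fun ρ ξ x hx => ?_⟩
  choose z' hz' v hv hle hval using fun i => hfatt i (yInf i)
  have hpenInf := hpen yInf hysum z' v hz' hv hle
  simp only [hval] at hpenInf
  have hv0 : ∀ i, v i = 0 := fun i =>
    (Finset.sum_eq_zero_iff_of_nonneg fun i _ => hv i).1
      (le_antisymm (by linarith) (Finset.sum_nonneg fun i _ => hv i)) i (Finset.mem_univ i)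
  have hzy : ∀ i, P.A i *ᵥ z' i ≤ yInf i := fun i s => by
    have := hle i s
    simpa [hv0 i] using this
  have hval' : ∑ i, P.c i ⬝ᵥ z' i ≤ ∑ i, P.c i ⬝ᵥ z i := by
    simpa [← hval, hv0] using hyval
  have hopt : P.IsLPOptimal (fun _ => P.sigmaASY xL) z' := by
    refine ⟨⟨hz', ?_⟩, fun w hw => hval'.trans (hz.2 w hw)⟩
    rw [← hysum]
    exact Finset.sum_le_sum fun i _ => hzy i
  obtain rfl : z' = z := huniq z' hopt
  exact P.isFeasible_of_isLexOptimal hcpt (fun i => (hxL i).1.1) hysum hz' hzy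
    (P.card_notMem_X_le hz huniq) hx
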